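/- Theorem 2 (Coupled Environments). Setting. Let $\mathcal G$ be a DAG on $[n]=\{1,\dots,n\}$ with parent sets $\mathrm{Pa}(i)$, and let $Z=(Z_1,\dots,Z_n)$ have the density $p(z)=\prod_{i=1}^n p_i(z_i\mid z_{\mathrm{Pa}(i)})$ on $\mathbb R^n$, where the conditional pdfs $p_i$ are continuously differentiable in all variables, $p(z)\neq 0$ for all $z$, and every edge is genuine, i.e. for $j\in \mathrm{Pa}(i)$ the function $p_i(z_i\mid z_{\mathrm{Pa}(i)})$ is not constant in $z_j$. One observes $X=g(Z)\in\mathbb R^d$, $d\ge n$, where $g:\mathbb R^n\to\mathbb R^d$ is an unknown $C^1$ diffeomorphism onto its image $\mathcal X$ ($g$ and its inverse on $\mathcal X$ are continuously differentiable). For every node $i$ there are two hard interventional mechanisms, continuously differentiable nowhere vanishing pdfs $q_i,\tilde q_i$ on $\mathbb R$, such that $(q_i,\tilde q_i)$ satisfies interventional discrepancy: $\frac{\partial}{\partial u}\frac{q_i(u)}{\tilde q_i(u)}\neq 0$ for all $u$ outside a Lebesgue null set. Besides the observational environment $\mathcal E^0$ (density $p$ of $Z$) there are two families of environments $\mathcal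 E^m,\tilde{\mathcal E}^m$, $m\in[n]$, that are coupled: for an unknown permutation $I$ of $[n]$, in both $\mathcal E^m$ and $\tilde{\mathcal E}^m$ the node $\ell=I^m$ is intervened, so that $Z$ has there the density $q_\ell(z_\ell)\prod_{i\neq \ell}p_i(z_i\mid z_{\mathrm{Pa}(i)})$, respectively $\tilde q_\ell(z_\ell)\prod_{i\neq \ell}p_i(z_i\mid z_{\mathrm{Pa}(i)})$. The learner knows $\mathcal X$ and the laws of $X$ in all these environments. Algorithm. Let $\mathcal H$ be the set of valid encoders, i.e. of the $C^1$ diffeomorphisms $h$ of $\mathcal X$ onto their image in $\mathbb R^n$. For $h\in\mathcal H$ let $\hat Z=h(X)$, let $p_{\hat Z},p^m_{\hat Z},\tilde p^m_{\hat Z}$ be the continuous densities on $h(\mathcal X)$ of $\hat Z$ in $\mathcal E^0,\mathcal E^m,\tilde{\mathcal E}^m$, and define $n\times n$ matrices with entries in $[0,\infty]$ by $$[D_{\rm t}(h)]_{i,m}=\mathbb E\Big|\big[\nabla(\log p^m_{\hat Z}-\log\tilde p^m_{\hat Z})(\hat Z)\big]_i\Big|,\qquad [D(h)]_{i,m}=\mathbb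 E\Big|\big[\nabla(\log p_{\hat Z}-\log p^m_{\hat Z})(\hat Z)\big]_i\Big|,$$ with expectations over the observational data. (These gradients are the differences of the score functions.) Let $\|\cdot\|_0$ be the number of nonzero entries, and let $h^*$ be a solution of $$\mathcal P_1:\quad \min_{h\in\mathcal H}\|D_{\rm t}(h)\|_0\quad\text{subject to } D_{\rm t}(h)\text{ being diagonal}.$$ Let $\hat{\mathcal G}$ be the graph on $[n]$ in which the parents of $i$ are the $j\neq i$ with $[D(h^*)]_{j,i}\neq 0$. Claim. $\mathcal P_1$ has a solution, and for every solution $h^*$: (a) the Jacobian of $h^*\circ g$ has the pattern of a permutation matrix: for all $z\in\mathbb R^n$ and $m,j\in[n]$, $[J_{h^*\circ g}(z)]_{m,j}\neq 0$ if and only if $j=I^m$; (b) latent recovery is perfect: there are a permutation $\pi$ of $[n]$ and functions $\phi_i:\mathbb R\to\mathbb R$, each a $C^1$ diffeomorphism onto its image (which is $\mathbb R$ if $h^*$ maps $\mathcal X$ onto $\mathbb R^n$), with $[h^*(g(z))]_m=\phi_{\pi_m}(z_{\pi_m})$ for all $z\in\mathbb R^n$ and $m\in[n]$; (c) DAG recovery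 is perfect: $\hat{\mathcal G}$ is isomorphic to $\mathcal G$; in fact $m\to m'$ in $\hat{\mathcal G}$ if and only if $I^m\to I^{m'}$ in $\mathcal G$. -/

import Mathlib

open MeasureTheory

noncomputable section

namespace CRL

/-! ### Latent causal model -/

/-- `f` is a probability density function on `ℝ` with respect to Lebesgue measure. -/
def IsPDF (f : ℝ → ℝ) : Prop :=
  (∀ u, 0 ≤ f u) ∧ ∫⁻ u, ENNReal.ofReal (f u) = 1

/-- A directed graph is acyclic when no vertex can be reached from itself by a nonempty
directed path. -/
def IsDAG {V : Type*} (G : Digraph V) : Prop :=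
  ∀ v, ¬ Relation.TransGen G.Adj v v

/-- A latent causal model on `n` real variables: a DAG on `n` nodes (`G.Adj j i` means that `j` is a
parent of `i`), and for every node `i` the conditional density `p i u w` of `Z_i = u` given that
the parents of `i` have the values `w`. -/
structure LatentModel (n : ℕ) where
  /-- The latent graph. -/
  G : Digraph (Fin n)
  /-- The conditional density of every node given its parents. -/
  p : (i : Fin n) → ℝ → ({j : Fin n // G.Adj j i} → ℝ) → ℝ
  isDAG : IsDAG G
  isPDF : ∀ i w, IsPDF fun u => p i u w
  /-- `p_i(z_i ∣ z_Pa(i))` is continuously differentiable in all `z` variables. -/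
  contDiff : ∀ i, ContDiff ℝ 1 fun z : Fin n → ℝ => p i (z i) fun j => z j.1
  /-- Every edge `j → i` is genuine: `p_i(z_i ∣ z_Pa(i))` is not constant in the variable `z_j`. -/
  depends : ∀ (i : Fin n) (j : {j : Fin n // G.Adj j i}), ∃ u w w',
    (∀ k, k ≠ j → w k = w' k) ∧ p i u w ≠ p i u w'
  /-- The joint density has full support. -/
  ne_zero : ∀ z : Fin n → ℝ, ∏ i, p i (z i) (fun j => z j.1) ≠ 0

variable {n d : ℕ}

/-- The conditional density `p_i(z_i ∣ z_Pa(i))` as a function of the whole vector `z`. -/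
def LatentModel.cond (M : LatentModel n) (i : Fin n) (z : Fin n → ℝ) : ℝ :=
  M.p i (z i) fun j => z j.1

/-- The observational density `p(z) = ∏ i, p_i(z_i ∣ z_Pa(i))`. -/
def LatentModel.obsDensity (M : LatentModel n) (z : Fin n → ℝ) : ℝ :=
  ∏ i, M.cond i z

/-- The density after a hard intervention that replaces the mechanism of node `l` by `q`. -/
def LatentModel.hardDensity (M : LatentModel n) (l : Fin n) (q : ℝ → ℝ) (z : Fin n → ℝ) : ℝ :=
  q (z l) * ∏ i ∈ Finset.univ.erase l, M.cond i z

/-- A hard interventional mechanism: a continuously differentiable pdf on `ℝ` with full support. -/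
def IsMechanism (q : ℝ → ℝ) : Prop :=
  IsPDF q ∧ ContDiff ℝ 1 q ∧ ∀ u, q u ≠ 0

/-- Interventional discrepancy of two mechanisms: the derivative of their ratio is nonzero outside
a Lebesgue null set. -/
def InterventionalDiscrepancy (p q : ℝ → ℝ) : Prop :=
  ∃ T : Set ℝ, volume T = 0 ∧ ∀ u, u ∉ T → deriv (fun v => p v / q v) u ≠ 0

/-! ### Observed data -/

/-- `f` restricts to a `C¹` diffeomorphism from `S` onto its image `f '' S`: it is `C¹` on `S` and
has an inverse that is `C¹` on `f '' S`. -/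
def IsDiffeoOntoImage {E F : Type*} [NormedAddCommGroup E] [NormedSpace ℝ E]
    [NormedAddCommGroup F] [NormedSpace ℝ F] (f : E → F) (S : Set E) : Prop :=
  ContDiffOn ℝ 1 f S ∧ ∃ k : F → E, Set.LeftInvOn k f S ∧ ContDiffOn ℝ 1 k (f '' S)

/-- What the learner has: the set in which `X` takes its values, the law of `X` in the
observational environment, and the laws of `X` in the two families of interventional
environments. -/
structure ObservedData (n d : ℕ) where
  image : Set (Fin d → ℝ)
  obs : Measure (Fin d → ℝ)
  env : Fin n → Measure (Fin d → ℝ)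
  envTilde : Fin n → Measure (Fin d → ℝ)

/-- The law on `ℝⁿ` with density `f`. -/
def lawOf (f : (Fin n → ℝ) → ℝ) : Measure (Fin n → ℝ) :=
  volume.withDensity fun z => ENNReal.ofReal (f z)

/-- The data generated by the latent model `M` through `X = g(Z)`, where the environment `m` of
the first family replaces the mechanism of node `I m` by `q (I m)`, and the environment `m` of the
second family replaces the mechanism of node `It m` by `qt (It m)`. -/
def generatedData (M : LatentModel n) (q qt : Fin n → ℝ → ℝ) (I It : Equiv.Perm (Fin n))
    (g : (Fin n → ℝ) → (Fin d → ℝ)) : ObservedData n d where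
  image := Set.range g
  obs := (lawOf M.obsDensity).map g
  env m := (lawOf (M.hardDensity (I m) (q (I m)))).map g
  envTilde m := (lawOf (M.hardDensity (It m) (qt (It m)))).map g

/-! ### Scores and score change matrices -/

/-- `f` is the continuous density, on the set `U`, of a law `μ` that is carried by `U`. -/
def IsContDensity (U : Set (Fin n → ℝ)) (μ : Measure (Fin n → ℝ)) (f : (Fin n → ℝ) → ℝ) : Prop :=
  ContinuousOn f U ∧ (∀ w ∈ U, 0 ≤ f w) ∧
    μ = volume.withDensity (U.indicator fun w => ENNReal.ofReal (f w))

/-- The continuous density of `μ` on `U` (arbitrary if there is none). On an open set `U` its values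
are determined by `μ`, see `IsContDensity.eqOn`. -/
def density (U : Set (Fin n → ℝ)) (μ : Measure (Fin n → ℝ)) : (Fin n → ℝ) → ℝ :=
  Classical.epsilon (IsContDensity U μ)

/-- The continuous density on an open set is unique. -/
theorem IsContDensity.eqOn {U : Set (Fin n → ℝ)} (hU : IsOpen U) {μ : Measure (Fin n → ℝ)}
    {f f' : (Fin n → ℝ) → ℝ} (hf : IsContDensity U μ f) (hf' : IsContDensity U μ f') :
    Set.EqOn f f' U := by
  have key : ∀ {f : (Fin n → ℝ) → ℝ}, ContinuousOn f U →
      AEMeasurable (U.indicator fun w => ENNReal.ofReal (f w)) volume := fun h =>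
    (aemeasurable_indicator_iff hU.measurableSet).2
      (h.aemeasurable hU.measurableSet).ennreal_ofReal
  have h1 : (U.indicator fun w => ENNReal.ofReal (f w)) =ᵐ[volume]
      (U.indicator fun w => ENNReal.ofReal (f' w)) := by
    have h2 := hf.2.2.symm.trans hf'.2.2
    refine (withDensity_eq_iff_of_sigmaFinite (key hf.1) (key hf'.1)).1 h2
  have h3 : f =ᵐ[volume.restrict U] f' := by
    refine (ae_restrict_iff' hU.measurableSet).2 ?_
    filter_upwards [h1] with w hw hwU
    simp only [Set.indicator_of_mem hwU] at hw
    exact (ENNReal.ofReal_eq_ofReal_iff (hf.2.1 w hwU) (hf'.2.1 w hwU)).1 hw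
  exact Measure.eqOn_open_of_ae_eq h3 hU hf.1 hf'.1

/-- The `i`-th coordinate at `w` of the difference of the scores of `μ` and `ν`, where both laws
are carried by `U`: the partial derivative of `log f_μ - log f_ν` for the densities `f_μ`, `f_ν`. -/
def scoreDiff (U : Set (Fin n → ℝ)) (μ ν : Measure (Fin n → ℝ)) (w : Fin n → ℝ) (i : Fin n) : ℝ :=
  fderiv ℝ (fun v => Real.log (density U μ v) - Real.log (density U ν v)) w (Pi.single i 1)

/-- `E |[s_μ(Ẑ) - s_ν(Ẑ)]_i|`, where `Ẑ = h(X)`, the scores are those of the laws of `Ẑ` when `X`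
has the law `μ`, respectively `ν`, and the expectation is over observational data `X`. The value
is an extended nonnegative real. -/
def expectedScoreChange (D : ObservedData n d) (μ ν : Measure (Fin d → ℝ))
    (h : (Fin d → ℝ) → (Fin n → ℝ)) (i : Fin n) : ENNReal :=
  ∫⁻ x, ENNReal.ofReal |scoreDiff (h '' D.image) (μ.map h) (ν.map h) (h x) i| ∂D.obs

/-- The score change matrix `D_t(h)` between the two families of interventional environments. -/
def Dt (D : ObservedData n d) (h : (Fin d → ℝ) → (Fin n → ℝ)) :
    Matrix (Fin n) (Fin n) ENNReal :=
  Matrix.of fun i m => expectedScoreChange D (D.env m) (D.envTilde m) h i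

/-- The score change matrix `D(h)` between the observational environment and the first family. -/
def Dobs (D : ObservedData n d) (h : (Fin d → ℝ) → (Fin n → ℝ)) :
    Matrix (Fin n) (Fin n) ENNReal :=
  Matrix.of fun i m => expectedScoreChange D D.obs (D.env m) h i

/-! ### The algorithm -/

/-- A valid encoder: `h` maps the set of observations diffeomorphically onto its image in `ℝⁿ`, so
that it has a decoder `h⁻¹` with `h⁻¹ (h x) = x`. -/
def IsValidEncoder (D : ObservedData n d) (h : (Fin d → ℝ) → (Fin n → ℝ)) : Prop :=
  IsDiffeoOntoImage h D.image

/-- The `ℓ₀` norm: the number of nonzero entries. -/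
def l0norm (A : Matrix (Fin n) (Fin n) ENNReal) : ℕ :=
  {e : Fin n × Fin n | A e.1 e.2 ≠ 0}.ncard

/-- `h` solves the problem of minimizing `‖D_t(h)‖₀` over all valid encoders `h` for which `D_t(h)`
is diagonal. -/
def IsSolution (D : ObservedData n d) (h : (Fin d → ℝ) → (Fin n → ℝ)) : Prop :=
  IsValidEncoder D h ∧ (Dt D h).IsDiag ∧
    ∀ h', IsValidEncoder D h' → (Dt D h').IsDiag → l0norm (Dt D h) ≤ l0norm (Dt D h')

/-- The graph read off from the support of `D(h)`: the parents of `i` are the `j ≠ i` with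
`[D(h)]_{j,i} ≠ 0`. -/
def recoveredGraph (D : ObservedData n d) (h : (Fin d → ℝ) → (Fin n → ℝ)) : Digraph (Fin n) where
  Adj j i := j ≠ i ∧ Dobs D h j i ≠ 0

/-! ### Perfect recovery -/

/-- The estimate `Ẑ = h(X)` is an element-wise diffeomorphism of a permutation of `Z`:
`[h(g(z))]_m = φ_{π m}(z_{π m})`. Each `φ_i` is a diffeomorphism onto its image, which is all of `ℝ`
as soon as `h` maps the set of observations onto `ℝⁿ`. -/
def PerfectLatentRecovery (g : (Fin n → ℝ) → (Fin d → ℝ)) (h : (Fin d → ℝ) → (Fin n → ℝ)) : Prop :=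
  ∃ (π : Equiv.Perm (Fin n)) (φ : Fin n → ℝ → ℝ),
    (∀ i, IsDiffeoOntoImage (φ i) Set.univ) ∧
    (Function.Surjective (h ∘ g) → ∀ i, Function.Surjective (φ i)) ∧
    ∀ z m, h (g z) m = φ (π m) (z (π m))

/-- The estimated graph is isomorphic to the true one. -/
def PerfectDAGRecovery (G Ghat : Digraph (Fin n)) : Prop :=
  Nonempty (Ghat.Adj ≃r G.Adj)

end CRL

end

/-! Put `φ = h ∘ g`, a diffeomorphism onto an open set, with inverse `ψ`. When two latent densities
`f₁`, `f₂` are pushed forward by `φ`, both acquire the same Jacobian factor, so it cancels in the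
score difference: its `i`-th coordinate at `φ z` is the derivative of `log f₁ - log f₂` at `z` along
the column `∂ᵢψ` (`IsDiffeoPair.scoreDiff_eq`). For a coupled pair of environments the log-ratio
depends on `z (I m)` alone. By interventional discrepancy and continuity, entry `(i, m)` of `Dt`
vanishes exactly when the component `I m` of `∂ᵢψ` vanishes identically (`Dt_eq_zero_iff`).
Diagonality thus leaves column `i` of the Jacobian of `ψ` only its entry in row `I i`, and
invertibility makes that entry nonzero at every point. Hence every feasible encoder has the
objective value `n` (`l0norm_Dt_eq`), feasible and optimal mean the same, and existence only needs
`g⁻¹` followed by a permutation. The Jacobian of `φ` inherits the pattern, so each coordinate of `φ`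
is a function of one variable (`IsDiffeoPair.exists_coordinatewise`). For the graph, `log p - log
p^m` is the log-conditional of node `I m` minus `log q`; along another axis `I j` only the
conditional can vary, and it does so exactly when `I j` is a parent (`recoveredGraph_adj_iff`). -/

namespace CRL

variable {n d : ℕ}

/-! ### Functions with a vanishing directional derivative -/

/-- A function whose derivative in the direction `v` vanishes everywhere is invariant under
translation by `v`. -/
theorem add_eq_of_fderiv_apply_eq_zero {E : Type*} [NormedAddCommGroup E] [NormedSpace ℝ E]
    {f : E → ℝ} (hf : Differentiable ℝ f) {v : E} (h : ∀ z, fderiv ℝ f z v = 0) (z : E) :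
    f (z + v) = f z := by
  have hd : ∀ t : ℝ, HasDerivAt (fun t : ℝ => f (z + t • v)) 0 t := by
    intro t
    have h1 : HasDerivAt (fun t : ℝ => z + t • v) v t := by
      simpa using ((hasDerivAt_id t).smul_const v).const_add z
    have h2 := (hf (z + t • v)).hasFDerivAt.comp_hasDerivAt t h1
    rwa [h] at h2
  have := is_const_of_deriv_eq_zero (fun t => (hd t).differentiableAt) (fun t => (hd t).deriv) 1 0
  simpa using this

/-- The derivative in the direction `v` vanishes if the function is invariant under translation
by the multiples of `v`. -/
theorem fderiv_apply_eq_zero_of_add_eq {E : Type*} [NormedAddCommGroup E] [NormedSpace ℝ E]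
    {f : E → ℝ} {z v : E} (hf : DifferentiableAt ℝ f z)
    (h : ∀ t : ℝ, f (z + t • v) = f z) : fderiv ℝ f z v = 0 := by
  have h1 : HasDerivAt (fun t : ℝ => z + t • v) v 0 := by
    simpa using ((hasDerivAt_id (0 : ℝ)).smul_const v).const_add z
  have h2 : HasFDerivAt f (fderiv ℝ f z) (z + (0 : ℝ) • v) := by simpa using hf.hasFDerivAt
  have h3 := h2.comp_hasDerivAt (0 : ℝ) h1
  have h4 : (f ∘ fun t : ℝ => z + t • v) = fun _ => f z := funext h
  rw [h4] at h3
  exact h3.unique (hasDerivAt_const _ _)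

/-! ### Diffeomorphisms onto their image -/

section Diffeo

variable {φ ψ : (Fin n → ℝ) → (Fin n → ℝ)}

/-- `φ` is a `C¹` map with left inverse `ψ` that is `C¹` on the range of `φ`. -/
structure IsDiffeoPair (φ ψ : (Fin n → ℝ) → (Fin n → ℝ)) : Prop where
  contDiff : ContDiff ℝ 1 φ
  leftInv : Function.LeftInverse ψ φ
  contDiffOn : ContDiffOn ℝ 1 ψ (Set.range φ)

theorem IsDiffeoOntoImage.exists_pair (h : IsDiffeoOntoImage φ Set.univ) :
    ∃ ψ, IsDiffeoPair φ ψ := by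
  obtain ⟨h1, ψ, h2, h3⟩ := h
  exact ⟨ψ, contDiffOn_univ.1 h1, fun z => h2 (Set.mem_univ z), by simpa using h3⟩

theorem IsDiffeoOntoImage.comp_univ {E F G : Type*} [NormedAddCommGroup E] [NormedSpace ℝ E]
    [NormedAddCommGroup F] [NormedSpace ℝ F] [NormedAddCommGroup G] [NormedSpace ℝ G]
    {g : E → F} {h : F → G} (hg : IsDiffeoOntoImage g Set.univ)
    (hh : IsDiffeoOntoImage h (Set.range g)) : IsDiffeoOntoImage (h ∘ g) Set.univ := by
  obtain ⟨hg, k, hk, hkc⟩ := hg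
  obtain ⟨hh, k', hk', hkc'⟩ := hh
  rw [Set.image_univ] at hkc
  refine ⟨hh.comp hg fun z _ => Set.mem_range_self z, k ∘ k', ?_, ?_⟩
  · intro z hz
    simp [hk' (Set.mem_range_self z), hk hz]
  · rw [Set.image_comp, Set.image_univ]
    refine hkc.comp hkc' ?_
    rintro _ ⟨x, hx, rfl⟩
    rwa [hk' hx]

namespace IsDiffeoPair

variable (H : IsDiffeoPair φ ψ)
include H

theorem hasFDerivAt (z : Fin n → ℝ) : HasFDerivAt φ (fderiv ℝ φ z) z :=
  (H.contDiff.differentiable one_ne_zero z).hasFDerivAt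

/-- Chain rule for `ψ ∘ φ = id`. The derivative of `ψ` is taken within the range because openness of
the range is only deduced from this identity. -/
theorem fderivWithin_comp (z : Fin n → ℝ) :
    (fderivWithin ℝ ψ (Set.range φ) (φ z)).comp (fderiv ℝ φ z) =
      ContinuousLinearMap.id ℝ (Fin n → ℝ) := by
  have h1 := (H.contDiffOn.differentiableOn one_ne_zero (φ z)
    (Set.mem_range_self z)).hasFDerivWithinAt
  have h2 := h1.comp_hasFDerivAt z (H.hasFDerivAt z) (Filter.Eventually.of_forall fun y => Set.mem_range_self y)
  have h3 : ψ ∘ φ = id := H.leftInv.comp_eq_id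
  rw [h3] at h2
  exact h2.unique (hasFDerivAt_id z)

/-- A left inverse makes the derivative injective, and an injective endomorphism in finite dimension
is bijective. This feeds the inverse function theorem in `isOpenMap`. -/
theorem exists_equiv (z : Fin n → ℝ) :
    ∃ e : (Fin n → ℝ) ≃L[ℝ] (Fin n → ℝ), (e : (Fin n → ℝ) →L[ℝ] (Fin n → ℝ)) = fderiv ℝ φ z := by
  have hinj : Function.Injective (fderiv ℝ φ z) :=
    Function.LeftInverse.injective (g := fderivWithin ℝ ψ (Set.range φ) (φ z)) fun v =>
      DFunLike.congr_fun (H.fderivWithin_comp z) v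
  refine ⟨(LinearEquiv.ofInjectiveEndo (fderiv ℝ φ z : (Fin n → ℝ) →ₗ[ℝ] (Fin n → ℝ))
    hinj).toContinuousLinearEquiv, ?_⟩
  ext v
  simp

theorem isOpenMap : IsOpenMap φ := by
  choose e he using H.exists_equiv
  refine isOpenMap_of_hasStrictFDerivAt_equiv (f' := e) fun z => ?_
  rw [he]
  exact H.contDiff.contDiffAt.hasStrictFDerivAt one_ne_zero

theorem isOpen_range : IsOpen (Set.range φ) := H.isOpenMap.isOpen_range

theorem contDiffAt (z : Fin n → ℝ) : ContDiffAt ℝ 1 ψ (φ z) :=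
  H.contDiffOn.contDiffAt (H.isOpen_range.mem_nhds (Set.mem_range_self z))

theorem hasFDerivAt_inv (z : Fin n → ℝ) : HasFDerivAt ψ (fderiv ℝ ψ (φ z)) (φ z) :=
  ((H.contDiffAt z).differentiableAt one_ne_zero).hasFDerivAt

theorem fderiv_inv_comp (z : Fin n → ℝ) :
    (fderiv ℝ ψ (φ z)).comp (fderiv ℝ φ z) = ContinuousLinearMap.id ℝ (Fin n → ℝ) := by
  rw [← H.fderivWithin_comp z,
    fderivWithin_of_isOpen H.isOpen_range (Set.mem_range_self z)]

theorem fderiv_comp_inv (z : Fin n → ℝ) :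
    (fderiv ℝ φ z).comp (fderiv ℝ ψ (φ z)) = ContinuousLinearMap.id ℝ (Fin n → ℝ) := by
  obtain ⟨e, he⟩ := H.exists_equiv z
  have h1 := H.fderiv_inv_comp z
  rw [← he] at h1 ⊢
  ext1 v
  obtain ⟨u, rfl⟩ := e.surjective v
  have := DFunLike.congr_fun h1 u
  simpa using congrArg e this

theorem continuous_fderiv_inv : Continuous fun z => fderiv ℝ ψ (φ z) :=
  ContinuousOn.comp_continuous (H.contDiffOn.continuousOn_fderiv_of_isOpen H.isOpen_range le_rfl)
    H.contDiff.continuous fun z => Set.mem_range_self z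

theorem measurableEmbedding : MeasurableEmbedding φ :=
  H.contDiff.continuous.measurableEmbedding H.leftInv.injective

/-- The change of variables formula for densities. -/
theorem isContDensity {f : (Fin n → ℝ) → ℝ} (hf : Continuous f) (h0 : ∀ z, 0 ≤ f z) :
    IsContDensity (Set.range φ) ((lawOf f).map φ) fun w => f (ψ w) * |(fderiv ℝ ψ w).det| := by
  have hU := H.isOpen_range
  refine ⟨?_, fun w _ => mul_nonneg (h0 _) (abs_nonneg _), ?_⟩
  · refine (hf.comp_continuousOn H.contDiffOn.continuousOn).mul (ContinuousOn.abs ?_)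
    exact ContinuousLinearMap.continuous_det.comp_continuousOn
      (H.contDiffOn.continuousOn_fderiv_of_isOpen hU le_rfl)
  · ext A hA
    have hφm := H.contDiff.continuous.measurable
    rw [Measure.map_apply hφm hA, lawOf, withDensity_apply _ (hφm hA), withDensity_apply _ hA,
      lintegral_indicator hU.measurableSet, Measure.restrict_restrict hU.measurableSet,
      ← Set.image_preimage_eq_range_inter,
      lintegral_image_eq_lintegral_abs_det_fderiv_mul volume (hφm hA)
        (fun z _ => (H.hasFDerivAt z).hasFDerivWithinAt) H.leftInv.injective.injOn]
    refine lintegral_congr fun z => ?_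
    rw [← ENNReal.ofReal_mul (abs_nonneg _)]
    dsimp only
    rw [H.leftInv z]
    congr 1
    -- The determinants of mutually inverse Jacobians cancel the factor produced by the change of
    -- variables.
    have h1 : (fderiv ℝ ψ (φ z)).det * (fderiv ℝ φ z).det = 1 := by
      have := congrArg ContinuousLinearMap.det (H.fderiv_inv_comp z)
      simpa [ContinuousLinearMap.det, LinearMap.det_comp] using this
    have h2 : |(fderiv ℝ φ z).det| * |(fderiv ℝ ψ (φ z)).det| = 1 := by
      rw [← abs_mul, mul_comm, h1, abs_one]
    linear_combination -(f z) * h2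

/-- The Jacobian cancels in the difference of two scores. -/
theorem scoreDiff_eq {f₁ f₂ : (Fin n → ℝ) → ℝ} (h₁ : ContDiff ℝ 1 f₁) (h₂ : ContDiff ℝ 1 f₂)
    (h₁0 : ∀ z, 0 < f₁ z) (h₂0 : ∀ z, 0 < f₂ z) (z : Fin n → ℝ) (i : Fin n) :
    scoreDiff (Set.range φ) ((lawOf f₁).map φ) ((lawOf f₂).map φ) (φ z) i =
      fderiv ℝ (fun z => Real.log (f₁ z) - Real.log (f₂ z)) z
        (fderiv ℝ ψ (φ z) (Pi.single i 1)) := by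
  have hdens : ∀ {f : (Fin n → ℝ) → ℝ}, Continuous f → (∀ z, 0 < f z) →
      ∀ z, density (Set.range φ) ((lawOf f).map φ) (φ z) =
        f z * |(fderiv ℝ ψ (φ z)).det| := by
    intro f hf h0 z
    have hc := H.isContDensity hf fun z => (h0 z).le
    -- The explicit density shows that the `epsilon` choice is a genuine continuous density;
    -- uniqueness on the open range then identifies the two.
    have hspec : IsContDensity (Set.range φ) ((lawOf f).map φ)
        (density (Set.range φ) ((lawOf f).map φ)) := Classical.epsilon_spec ⟨_, hc⟩
    have := hspec.eqOn H.isOpen_range hc (Set.mem_range_self z)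
    simpa [H.leftInv z] using this
  have hdet : ∀ z, |(fderiv ℝ ψ (φ z)).det| ≠ 0 := by
    intro z h
    have := congrArg ContinuousLinearMap.det (H.fderiv_inv_comp z)
    rw [abs_eq_zero] at h
    simp only [ContinuousLinearMap.det] at h this
    simp [LinearMap.det_comp, h] at this
  -- The formula holds only on the range, but that is a neighbourhood of `φ z`, which suffices for
  -- the derivative.
  have hev : (fun v => Real.log (density (Set.range φ) ((lawOf f₁).map φ) v) -
      Real.log (density (Set.range φ) ((lawOf f₂).map φ) v)) =ᶠ[nhds (φ z)]
      (fun z => Real.log (f₁ z) - Real.log (f₂ z)) ∘ ψ := by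
    filter_upwards [H.isOpen_range.mem_nhds (Set.mem_range_self z)]
    rintro _ ⟨y, rfl⟩
    rw [hdens h₁.continuous h₁0, hdens h₂.continuous h₂0, Real.log_mul (h₁0 y).ne' (hdet y),
      Real.log_mul (h₂0 y).ne' (hdet y)]
    simp [H.leftInv y]
  have hd : DifferentiableAt ℝ (fun z => Real.log (f₁ z) - Real.log (f₂ z)) (ψ (φ z)) :=
    (((h₁.differentiable one_ne_zero) _).log (h₁0 _).ne').sub
      (((h₂.differentiable one_ne_zero) _).log (h₂0 _).ne')
  rw [scoreDiff, hev.fderiv_eq, fderiv_comp _ hd (H.hasFDerivAt_inv z).differentiableAt,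
    H.leftInv z]
  rfl

end IsDiffeoPair

end Diffeo

/-! ### Expected score changes -/

theorem map_map_of_continuousOn {g : (Fin n → ℝ) → (Fin d → ℝ)} {h : (Fin d → ℝ) → (Fin n → ℝ)}
    (hg : MeasurableEmbedding g) (hh : ContinuousOn h (Set.range g))
    (μ : Measure (Fin n → ℝ)) : (μ.map g).map h = μ.map (h ∘ g) := by
  refine AEMeasurable.map_map_of_aemeasurable ?_ hg.measurable.aemeasurable
  -- `h` is arbitrary off the range of `g`; a.e. measurability comes from the law being carried by
  -- that range.
  have h1 : (μ.map g).restrict (Set.range g) = μ.map g := by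
    refine Measure.restrict_eq_self_of_ae_mem ?_
    rw [hg.ae_map_iff]
    exact Filter.Eventually.of_forall fun z => Set.mem_range_self z
  rw [← h1]
  exact hh.aemeasurable hg.measurableSet_range

/-- An expected score change vanishes when the score change vanishes almost everywhere. -/
theorem expectedScoreChange_eq_zero_iff {g : (Fin n → ℝ) → (Fin d → ℝ)}
    {h : (Fin d → ℝ) → (Fin n → ℝ)} (hg : MeasurableEmbedding g)
    (hh : ContinuousOn h (Set.range g)) {ψ : (Fin n → ℝ) → (Fin n → ℝ)}
    (H : IsDiffeoPair (h ∘ g) ψ) (D : ObservedData n d) (hD : D.image = Set.range g)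
    {p : (Fin n → ℝ) → ℝ} (hp : Continuous p) (hp0 : ∀ z, 0 < p z)
    (hobs : D.obs = (lawOf p).map g)
    {f₁ f₂ : (Fin n → ℝ) → ℝ} (h₁ : ContDiff ℝ 1 f₁) (h₂ : ContDiff ℝ 1 f₂)
    (h₁0 : ∀ z, 0 < f₁ z) (h₂0 : ∀ z, 0 < f₂ z) (i : Fin n) :
    expectedScoreChange D ((lawOf f₁).map g) ((lawOf f₂).map g) h i = 0 ↔
      ∀ᵐ z, fderiv ℝ (fun z => Real.log (f₁ z) - Real.log (f₂ z)) z
        (fderiv ℝ ψ (h (g z)) (Pi.single i 1)) = 0 := by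
  have hF : ContDiff ℝ 1 fun z => Real.log (f₁ z) - Real.log (f₂ z) :=
    (h₁.log fun z => (h₁0 z).ne').sub (h₂.log fun z => (h₂0 z).ne')
  have hm : Measurable fun z => fderiv ℝ (fun z => Real.log (f₁ z) - Real.log (f₂ z)) z
      (fderiv ℝ ψ (h (g z)) (Pi.single i 1)) :=
    ((hF.continuous_fderiv one_ne_zero).clm_apply
      (H.continuous_fderiv_inv.clm_apply continuous_const)).measurable
  have hs : ∀ z, scoreDiff (h '' D.image) (((lawOf f₁).map g).map h) (((lawOf f₂).map g).map h)
      (h (g z)) i = fderiv ℝ (fun z => Real.log (f₁ z) - Real.log (f₂ z)) z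
        (fderiv ℝ ψ (h (g z)) (Pi.single i 1)) := by
    intro z
    rw [hD, map_map_of_continuousOn hg hh, map_map_of_continuousOn hg hh, ← Set.range_comp]
    exact H.scoreDiff_eq h₁ h₂ h₁0 h₂0 z i
  rw [expectedScoreChange, hobs, hg.lintegral_map]
  simp only [hs]
  -- Since `p` is positive everywhere, observational null sets and Lebesgue null sets coincide.
  rw [lintegral_eq_zero_iff (by fun_prop), lawOf, Filter.EventuallyEq,
    ae_withDensity_iff (by fun_prop)]
  refine Filter.eventually_congr (Filter.Eventually.of_forall fun z => ?_)
  simp [hp0 z]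

/-! ### The densities of a latent causal model -/

theorem IsMechanism.pos {q : ℝ → ℝ} (hq : IsMechanism q) (u : ℝ) : 0 < q u :=
  lt_of_le_of_ne (hq.1.1 u) (hq.2.2 u).symm

theorem InterventionalDiscrepancy.exists_deriv_log_ne_zero {p q : ℝ → ℝ} (hp : IsMechanism p)
    (hq : IsMechanism q) (h : InterventionalDiscrepancy p q) :
    ∃ T : Set ℝ, volume T = 0 ∧
      ∀ u, u ∉ T → deriv (fun v => Real.log (p v) - Real.log (q v)) u ≠ 0 := by
  obtain ⟨T, hT, h⟩ := h
  refine ⟨T, hT, fun u hu => ?_⟩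
  have h1 : (fun v => Real.log (p v) - Real.log (q v)) = fun v => Real.log (p v / q v) := by
    funext v
    rw [Real.log_div (hp.pos v).ne' (hq.pos v).ne']
  have hd : DifferentiableAt ℝ (fun v => p v / q v) u :=
    (hp.2.1.differentiable one_ne_zero u).div (hq.2.1.differentiable one_ne_zero u) (hq.2.2 u)
  have h0 : p u / q u ≠ 0 := div_ne_zero (hp.2.2 u) (hq.2.2 u)
  rw [h1, deriv.log hd h0]
  exact div_ne_zero (h u hu) h0

namespace LatentModel

variable (M : LatentModel n)

theorem cond_pos (i : Fin n) (z : Fin n → ℝ) : 0 < M.cond i z :=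
  lt_of_le_of_ne ((M.isPDF i _).1 _)
    (Finset.prod_ne_zero_iff.1 (M.ne_zero z) i (Finset.mem_univ i)).symm

theorem contDiff_cond (i : Fin n) : ContDiff ℝ 1 (M.cond i) := M.contDiff i

theorem obsDensity_pos (z : Fin n → ℝ) : 0 < M.obsDensity z :=
  Finset.prod_pos fun i _ => M.cond_pos i z

theorem contDiff_obsDensity : ContDiff ℝ 1 M.obsDensity :=
  contDiff_prod fun i _ => M.contDiff_cond i

theorem hardDensity_pos (l : Fin n) {q : ℝ → ℝ} (hq : IsMechanism q) (z : Fin n → ℝ) :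
    0 < M.hardDensity l q z :=
  mul_pos (hq.pos _) (Finset.prod_pos fun i _ => M.cond_pos i z)

theorem contDiff_hardDensity (l : Fin n) {q : ℝ → ℝ} (hq : IsMechanism q) :
    ContDiff ℝ 1 (M.hardDensity l q) :=
  (hq.2.1.comp (contDiff_apply ℝ ℝ l)).mul (contDiff_prod fun i _ => M.contDiff_cond i)

theorem log_hardDensity_sub (l : Fin n) {q qt : ℝ → ℝ} (hq : IsMechanism q)
    (hqt : IsMechanism qt) (z : Fin n → ℝ) :
    Real.log (M.hardDensity l q z) - Real.log (M.hardDensity l qt z) =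
      Real.log (q (z l)) - Real.log (qt (z l)) := by
  have h : ∏ i ∈ Finset.univ.erase l, M.cond i z ≠ 0 :=
    (Finset.prod_pos fun i _ => M.cond_pos i z).ne'
  rw [hardDensity, hardDensity, Real.log_mul (hq.pos _).ne' h, Real.log_mul (hqt.pos _).ne' h]
  ring

theorem log_obsDensity_sub (l : Fin n) {q : ℝ → ℝ} (hq : IsMechanism q) (z : Fin n → ℝ) :
    Real.log (M.obsDensity z) - Real.log (M.hardDensity l q z) =
      Real.log (M.cond l z) - Real.log (q (z l)) := by
  have h : ∏ i ∈ Finset.univ.erase l, M.cond i z ≠ 0 :=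
    (Finset.prod_pos fun i _ => M.cond_pos i z).ne'
  rw [obsDensity, hardDensity, ← Finset.mul_prod_erase _ _ (Finset.mem_univ l),
    Real.log_mul (hq.pos _).ne' h, Real.log_mul (M.cond_pos l z).ne' h]
  ring

theorem not_adj_self (i : Fin n) : ¬ M.G.Adj i i := fun h =>
  M.isDAG i (Relation.TransGen.single h)

/-- The conditional density of `i` does not depend on the other nodes that are not its parents,
and it depends on its parents. -/
theorem fderiv_cond_eq_zero_iff {i j : Fin n} (hij : j ≠ i) :
    (∀ z, fderiv ℝ (M.cond i) z (Pi.single j 1) = 0) ↔ ¬ M.G.Adj j i := by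
  have hd : Differentiable ℝ (M.cond i) := (M.contDiff_cond i).differentiable one_ne_zero
  constructor
  · intro h hadj
    obtain ⟨u, w, w', hw, hne⟩ := M.depends i ⟨j, hadj⟩
    classical
    -- Filling all non-parents with `u` also gives node `i` the value `u`, as `i` is not its own
    -- parent. Then `ext w` and `ext w'` differ by a multiple of the `j`-th basis vector.
    let ext (w : {j : Fin n // M.G.Adj j i} → ℝ) : Fin n → ℝ := fun k =>
      if hk : M.G.Adj k i then w ⟨k, hk⟩ else u
    have hext : ∀ w, M.cond i (ext w) = M.p i u w := by
      intro w
      have h1 : ext w i = u := dif_neg (M.not_adj_self i)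
      have h2 : (fun k : {j : Fin n // M.G.Adj j i} => ext w k.1) = w :=
        funext fun k => dif_pos k.2
      rw [cond, h1, h2]
    have hadd : ext w' = ext w + (w' ⟨j, hadj⟩ - w ⟨j, hadj⟩) • Pi.single j (1 : ℝ) := by
      funext k
      by_cases hkj : k = j
      · subst hkj
        simp [ext, hadj]
      · by_cases hk : M.G.Adj k i
        · simp [ext, hk, hkj, hw ⟨k, hk⟩ fun e => hkj (congrArg Subtype.val e)]
        · simp [ext, hk, hkj]
    refine hne ?_
    rw [← hext w, ← hext w', hadd]
    refine (add_eq_of_fderiv_apply_eq_zero hd (fun z => ?_) _).symm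
    rw [map_smul, h, smul_zero]
  · intro hadj z
    refine fderiv_apply_eq_zero_of_add_eq (hd z) fun t => ?_
    have hk : ∀ k : {j : Fin n // M.G.Adj j i},
        (z + t • Pi.single j (1 : ℝ) : Fin n → ℝ) k.1 = z k.1 := by
      intro k
      have : k.1 ≠ j := fun e => hadj (e ▸ k.2)
      simp [this]
    simp only [cond, hk]
    simp [hij.symm]

end LatentModel

/-! ### Supports of the score change matrices -/

/-- A continuous function that vanishes almost everywhere vanishes everywhere. -/
theorem forall_eq_zero_of_ae {f : (Fin n → ℝ) → ℝ} (hf : Continuous f)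
    (h : ∀ᵐ z, f z = 0) (z : Fin n → ℝ) : f z = 0 :=
  congrFun (Measure.eq_of_ae_eq h hf continuous_const) z

/-- A coordinate avoids almost surely a given null set. -/
theorem ae_apply_notMem {T : Set ℝ} (hT : volume T = 0) (l : Fin n) :
    ∀ᵐ z : Fin n → ℝ, z l ∉ T :=
  (Measure.quasiMeasurePreserving_eval (fun _ : Fin n => (volume : Measure ℝ)) l).ae
    (measure_eq_zero_iff_ae_notMem.1 hT)

section Support

variable {M : LatentModel n} {q qt : Fin n → ℝ → ℝ} {I : Equiv.Perm (Fin n)}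
  {g : (Fin n → ℝ) → (Fin d → ℝ)} {h : (Fin d → ℝ) → (Fin n → ℝ)}
  {ψ : (Fin n → ℝ) → (Fin n → ℝ)}

/-- The score change is a product: a component of `∂ᵢψ` times the derivative of `log (q / qt)` at `z
(I m)`. The second factor is nonzero almost everywhere, so the first vanishes almost everywhere and,
being continuous, everywhere. -/
theorem Dt_eq_zero_iff (hq : ∀ i, IsMechanism (q i)) (hqt : ∀ i, IsMechanism (qt i))
    (hdisc : ∀ i, InterventionalDiscrepancy (q i) (qt i))
    (hg : MeasurableEmbedding g) (hh : ContinuousOn h (Set.range g))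
    (H : IsDiffeoPair (h ∘ g) ψ) (i m : Fin n) :
    Dt (generatedData M q qt I I g) h i m = 0 ↔
      ∀ z, fderiv ℝ ψ (h (g z)) (Pi.single i 1) (I m) = 0 := by
  have h1 : Dt (generatedData M q qt I I g) h i m = expectedScoreChange
      (generatedData M q qt I I g) ((lawOf (M.hardDensity (I m) (q (I m)))).map g)
      ((lawOf (M.hardDensity (I m) (qt (I m)))).map g) h i := rfl
  rw [h1, expectedScoreChange_eq_zero_iff hg hh H (generatedData M q qt I I g) rfl
    M.contDiff_obsDensity.continuous M.obsDensity_pos rfl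
    (M.contDiff_hardDensity _ (hq _)) (M.contDiff_hardDensity _ (hqt _))
    (M.hardDensity_pos _ (hq _)) (M.hardDensity_pos _ (hqt _))]
  simp only [M.log_hardDensity_sub (I m) (hq (I m)) (hqt (I m))]
  have hF : ∀ z v : Fin n → ℝ,
      fderiv ℝ (fun z : Fin n → ℝ => Real.log (q (I m) (z (I m))) - Real.log (qt (I m) (z (I m))))
        z v = v (I m) *
          deriv (fun u => Real.log (q (I m) u) - Real.log (qt (I m) u)) (z (I m)) := by
    intro z v
    have hd : DifferentiableAt ℝ (fun u => Real.log (q (I m) u) - Real.log (qt (I m) u))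
        (z (I m)) :=
      (((hq _).2.1.differentiable one_ne_zero _).log ((hq _).2.2 _)).sub
        (((hqt _).2.1.differentiable one_ne_zero _).log ((hqt _).2.2 _))
    have := hd.hasDerivAt.comp_hasFDerivAt z (hasFDerivAt_apply (𝕜 := ℝ) (I m) z)
    rw [show (fun z : Fin n → ℝ => Real.log (q (I m) (z (I m))) - Real.log (qt (I m) (z (I m)))) =
      (fun u => Real.log (q (I m) u) - Real.log (qt (I m) u)) ∘ fun z : Fin n → ℝ => z (I m)
      from rfl, this.fderiv]
    simp [mul_comm]
  simp only [hF]
  constructor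
  · intro hz
    refine forall_eq_zero_of_ae ?_ ?_
    · exact (continuous_apply (I m)).comp (H.continuous_fderiv_inv.clm_apply continuous_const)
    · obtain ⟨T, hT, hne⟩ := (hdisc (I m)).exists_deriv_log_ne_zero (hq _) (hqt _)
      filter_upwards [hz, ae_apply_notMem hT (I m)] with z hz hzT
      exact (mul_eq_zero.1 hz).resolve_right (hne _ hzT)
  · intro hz
    exact Filter.Eventually.of_forall fun z => by rw [hz, zero_mul]

theorem Dobs_eq_zero_iff (hq : ∀ i, IsMechanism (q i))
    (hg : MeasurableEmbedding g) (hh : ContinuousOn h (Set.range g))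
    (H : IsDiffeoPair (h ∘ g) ψ) (i m : Fin n) :
    Dobs (generatedData M q qt I I g) h i m = 0 ↔
      ∀ z, fderiv ℝ (fun z => Real.log (M.cond (I m) z) - Real.log (q (I m) (z (I m)))) z
        (fderiv ℝ ψ (h (g z)) (Pi.single i 1)) = 0 := by
  have h1 : Dobs (generatedData M q qt I I g) h i m = expectedScoreChange
      (generatedData M q qt I I g) ((lawOf M.obsDensity).map g)
      ((lawOf (M.hardDensity (I m) (q (I m)))).map g) h i := rfl
  rw [h1, expectedScoreChange_eq_zero_iff hg hh H (generatedData M q qt I I g) rfl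
    M.contDiff_obsDensity.continuous M.obsDensity_pos rfl
    M.contDiff_obsDensity (M.contDiff_hardDensity _ (hq _))
    M.obsDensity_pos (M.hardDensity_pos _ (hq _))]
  simp only [M.log_obsDensity_sub (I m) (hq (I m))]
  refine ⟨fun hz => forall_eq_zero_of_ae ?_ hz, fun hz => Filter.Eventually.of_forall hz⟩
  have hF : ContDiff ℝ 1 fun z => Real.log (M.cond (I m) z) - Real.log (q (I m) (z (I m))) :=
    ((M.contDiff_cond _).log fun z => (M.cond_pos _ z).ne').sub
      (((hq (I m)).2.1.comp (contDiff_apply ℝ ℝ (I m))).log fun z => (hq (I m)).2.2 _)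
  exact (hF.continuous_fderiv one_ne_zero).clm_apply
    (H.continuous_fderiv_inv.clm_apply continuous_const)

end Support

/-! ### Feasible encoders -/

theorem l0norm_eq_of_diag {A : Matrix (Fin n) (Fin n) ENNReal} (hA : A.IsDiag)
    (h : ∀ i, A i i ≠ 0) : l0norm A = n := by
  have h1 : {e : Fin n × Fin n | A e.1 e.2 ≠ 0} = Set.range fun i : Fin n => (i, i) := by
    ext ⟨i, j⟩
    simp only [Set.mem_ofPred_eq, Set.mem_range, Prod.mk.injEq]
    constructor
    · intro hij
      refine ⟨i, rfl, ?_⟩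
      by_contra hne
      exact hij (hA hne)
    · rintro ⟨k, rfl, rfl⟩
      exact h k
  rw [l0norm, h1, ← Set.image_univ,
    Set.ncard_image_of_injective _ fun i j hij => congrArg Prod.fst hij, Set.ncard_univ, Nat.card_fin]

namespace IsDiffeoPair

variable {φ ψ : (Fin n → ℝ) → (Fin n → ℝ)} {I : Equiv.Perm (Fin n)}

/-- Otherwise a whole column of an invertible Jacobian would vanish. -/
theorem fderiv_inv_single_ne_zero (H : IsDiffeoPair φ ψ)
    (hz : ∀ z i m, i ≠ m → fderiv ℝ ψ (φ z) (Pi.single i 1) (I m) = 0) (z : Fin n → ℝ)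
    (i : Fin n) : fderiv ℝ ψ (φ z) (Pi.single i 1) (I i) ≠ 0 := by
  intro h0
  have h1 : fderiv ℝ ψ (φ z) (Pi.single i 1) = 0 := by
    funext k
    obtain ⟨m, rfl⟩ := I.surjective k
    by_cases him : i = m
    · subst him
      exact h0
    · exact hz z i m him
  have h2 := DFunLike.congr_fun (H.fderiv_comp_inv z) (Pi.single i 1)
  rw [ContinuousLinearMap.comp_apply, h1, map_zero] at h2
  simpa using congrFun h2 i

theorem fderiv_inv_single (hz : ∀ z i m, i ≠ m → fderiv ℝ ψ (φ z) (Pi.single i 1) (I m) = 0)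
    (z : Fin n → ℝ) (i : Fin n) : fderiv ℝ ψ (φ z) (Pi.single i 1) =
      fderiv ℝ ψ (φ z) (Pi.single i 1) (I i) • Pi.single (I i) (1 : ℝ) := by
  funext k
  obtain ⟨m, rfl⟩ := I.surjective k
  by_cases him : i = m
  · subst him
    simp
  · rw [hz z i m him]
    simp [Ne.symm him]

/-- If the Jacobian of the inverse has the pattern of a permutation matrix, so does the
Jacobian. -/
theorem fderiv_ne_zero_iff (H : IsDiffeoPair φ ψ)
    (hz : ∀ z i m, i ≠ m → fderiv ℝ ψ (φ z) (Pi.single i 1) (I m) = 0) (z : Fin n → ℝ)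
    (m j : Fin n) : fderiv ℝ φ z (Pi.single j 1) m ≠ 0 ↔ j = I m := by
  obtain ⟨i, rfl⟩ := I.surjective j
  have h2 := DFunLike.congr_fun (H.fderiv_comp_inv z) (Pi.single i 1)
  rw [ContinuousLinearMap.comp_apply, fderiv_inv_single hz, map_smul] at h2
  have h3 := congrFun h2 m
  simp only [Pi.smul_apply, smul_eq_mul, ContinuousLinearMap.id_apply] at h3
  rw [I.injective.eq_iff]
  constructor
  · intro hne
    by_contra him
    rw [Pi.single_eq_of_ne (Ne.symm him)] at h3
    exact (mul_ne_zero (H.fderiv_inv_single_ne_zero hz z i) hne) h3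
  · rintro rfl h0
    rw [h0] at h3
    simp at h3

/-- A coordinate of a diffeomorphism whose Jacobian has the pattern of a permutation matrix is a
function of a single variable. -/
theorem apply_eq_of_apply_eq (H : IsDiffeoPair φ ψ)
    (hJ : ∀ z m j, fderiv ℝ φ z (Pi.single j 1) m ≠ 0 ↔ j = I m) (m : Fin n)
    {z z' : Fin n → ℝ} (hzz : z (I m) = z' (I m)) : φ z m = φ z' m := by
  have hd : Differentiable ℝ φ := H.contDiff.differentiable one_ne_zero
  have hdm : ∀ z, HasFDerivAt (fun z => φ z m)
      ((ContinuousLinearMap.proj m).comp (fderiv ℝ φ z)) z := fun z =>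
    hasFDerivAt_pi'.1 (H.hasFDerivAt z) m
  -- The vector `z - z'` has no component along `I m`, and coordinate `m` of `φ` has zero derivative
  -- along every other axis.
  have key := add_eq_of_fderiv_apply_eq_zero (v := z - z') (fun z => (hdm z).differentiableAt)
    (fun y => ?_) z'
  · simpa using key
  · rw [(hdm y).fderiv, ContinuousLinearMap.comp_apply]
    have h1 : z - z' = ∑ j, (z - z') j • Pi.single j (1 : ℝ) := by
      conv_lhs => rw [← Finset.univ_sum_single (z - z')]
      refine Finset.sum_congr rfl fun j _ => ?_
      rw [← Pi.single_smul, smul_eq_mul, mul_one]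
    rw [h1, map_sum, map_sum]
    refine Finset.sum_eq_zero fun j _ => ?_
    rw [map_smul, map_smul]
    by_cases hj : j = I m
    · subst hj
      simp [hzz]
    · have : fderiv ℝ φ y (Pi.single j 1) m = 0 := not_not.1 fun h => hj ((hJ y m j).1 h)
      simp [this]

/-- A diffeomorphism whose Jacobian has the pattern of a permutation matrix acts on each
coordinate by a diffeomorphism of the line onto its image. -/
theorem exists_coordinatewise (H : IsDiffeoPair φ ψ)
    (hJ : ∀ z m j, fderiv ℝ φ z (Pi.single j 1) m ≠ 0 ↔ j = I m) :
    ∃ f : Fin n → ℝ → ℝ, (∀ i, IsDiffeoOntoImage (f i) Set.univ) ∧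
      (Function.Surjective φ → ∀ i, Function.Surjective (f i)) ∧
      ∀ z m, φ z m = f (I m) (z (I m)) := by
  have hφ : ∀ z m, φ z m = φ (Pi.single (I m) (z (I m))) m := fun z m =>
    H.apply_eq_of_apply_eq hJ m (by simp)
  have hs : ∀ i : Fin n, ContDiff ℝ 1 fun u : ℝ => (Pi.single i u : Fin n → ℝ) := fun i =>
    (ContinuousLinearMap.single ℝ (fun _ : Fin n => ℝ) i).contDiff
  -- Moving along axis `i` changes only the coordinate `I.symm i` of `φ`. So a line in the target,
  -- `φ 0` with that coordinate varied, supplies the inverse of the scalar map through `ψ`.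
  have hup : ∀ (i : Fin n) (u : ℝ), φ (Pi.single i u) =
      Function.update (φ 0) (I.symm i) (φ (Pi.single i u) (I.symm i)) := by
    intro i u
    funext m
    by_cases hm : m = I.symm i
    · subst hm
      simp
    · rw [Function.update_of_ne hm]
      refine H.apply_eq_of_apply_eq hJ m ?_
      have : I m ≠ i := fun e => hm (by simp [← e])
      simp [this]
  refine ⟨fun i u => φ (Pi.single i u) (I.symm i), fun i => ?_, fun hsurj i v => ?_,
    fun z m => by simpa using hφ z m⟩
  · refine ⟨((contDiff_apply ℝ ℝ (I.symm i)).comp (H.contDiff.comp (hs i))).contDiffOn,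
      fun v => ψ (Function.update (φ 0) (I.symm i) v) i, fun u _ => ?_, ?_⟩
    · dsimp only
      rw [← hup, H.leftInv]
      simp
    · have hu : ContDiff ℝ 1 fun v : ℝ => Function.update (φ 0) (I.symm i) v :=
        contDiff_update (𝕜 := ℝ) (F' := fun _ : Fin n => ℝ) 1 (φ 0) (I.symm i)
      refine (contDiff_apply ℝ ℝ i).comp_contDiffOn (H.contDiffOn.comp hu.contDiffOn ?_)
      rintro _ ⟨u, -, rfl⟩
      exact ⟨Pi.single i u, hup i u⟩
  · obtain ⟨z, hz⟩ := hsurj fun _ => v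
    refine ⟨z i, ?_⟩
    have := hφ z (I.symm i)
    rw [hz, Equiv.apply_symm_apply] at this
    exact this.symm

end IsDiffeoPair

/-- The encoder that inverts `g` up to a permutation of the coordinates. -/
theorem exists_isDiffeoPair_perm {g : (Fin n → ℝ) → (Fin d → ℝ)}
    (hg : IsDiffeoOntoImage g Set.univ) (I : Equiv.Perm (Fin n)) :
    ∃ h : (Fin d → ℝ) → (Fin n → ℝ), IsDiffeoOntoImage h (Set.range g) ∧
      ∀ z, h (g z) = fun m => z (I m) := by
  obtain ⟨hg, k, hk, hkc⟩ := hg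
  rw [Set.image_univ] at hkc
  have hk' : ∀ z, k (g z) = z := fun z => hk (Set.mem_univ z)
  refine ⟨fun x m => k x (I m), ⟨?_, fun w => g fun j => w (I.symm j), ?_, ?_⟩, fun z => ?_⟩
  · exact contDiffOn_pi.2 fun m => (contDiff_apply ℝ ℝ (I m)).comp_contDiffOn hkc
  · rintro _ ⟨z, rfl⟩
    simp [hk']
  · exact ((contDiffOn_univ.1 hg).comp
      (contDiff_pi.2 fun j => contDiff_apply ℝ ℝ (I.symm j))).contDiffOn
  · simp [hk']

theorem isDiffeoPair_perm (I : Equiv.Perm (Fin n)) :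
    IsDiffeoPair (fun z m => z (I m)) (fun w j => w (I.symm j)) :=
  ⟨contDiff_pi.2 fun m => contDiff_apply ℝ ℝ (I m), fun z => by simp,
    (contDiff_pi.2 fun j => contDiff_apply ℝ ℝ (I.symm j)).contDiffOn⟩

theorem fderiv_perm (I : Equiv.Perm (Fin n)) (w v : Fin n → ℝ) :
    fderiv ℝ (fun (w : Fin n → ℝ) j => w (I.symm j)) w v = fun j => v (I.symm j) := by
  have h : HasFDerivAt (fun (w : Fin n → ℝ) j => w (I.symm j))
      (ContinuousLinearMap.pi fun j => ContinuousLinearMap.proj (R := ℝ) (I.symm j)) w :=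
    hasFDerivAt_pi.2 fun j => hasFDerivAt_apply _ _
  rw [h.fderiv]
  rfl

section Recovery

variable {M : LatentModel n} {q qt : Fin n → ℝ → ℝ} {I : Equiv.Perm (Fin n)}
  {g : (Fin n → ℝ) → (Fin d → ℝ)} {h : (Fin d → ℝ) → (Fin n → ℝ)}
  {ψ : (Fin n → ℝ) → (Fin n → ℝ)}

theorem fderiv_inv_eq_zero_of_isDiag (hq : ∀ i, IsMechanism (q i)) (hqt : ∀ i, IsMechanism (qt i))
    (hdisc : ∀ i, InterventionalDiscrepancy (q i) (qt i))
    (hg : MeasurableEmbedding g) (hh : ContinuousOn h (Set.range g))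
    (H : IsDiffeoPair (h ∘ g) ψ) (hD : (Dt (generatedData M q qt I I g) h).IsDiag)
    (z : Fin n → ℝ) (i m : Fin n) (him : i ≠ m) :
    fderiv ℝ ψ ((h ∘ g) z) (Pi.single i 1) (I m) = 0 :=
  (Dt_eq_zero_iff hq hqt hdisc hg hh H i m).1 (hD him) z

/-- All feasible encoders have the same value of the objective. -/
theorem l0norm_Dt_eq (hq : ∀ i, IsMechanism (q i)) (hqt : ∀ i, IsMechanism (qt i))
    (hdisc : ∀ i, InterventionalDiscrepancy (q i) (qt i))
    (hg : MeasurableEmbedding g) (hh : ContinuousOn h (Set.range g))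
    (H : IsDiffeoPair (h ∘ g) ψ) (hD : (Dt (generatedData M q qt I I g) h).IsDiag) :
    l0norm (Dt (generatedData M q qt I I g) h) = n :=
  l0norm_eq_of_diag hD fun i h0 =>
    H.fderiv_inv_single_ne_zero (fderiv_inv_eq_zero_of_isDiag hq hqt hdisc hg hh H hD) 0 i
      ((Dt_eq_zero_iff hq hqt hdisc hg hh H i i).1 h0 0)

/-- For `h (g z) = z ∘ I` the Jacobian of the inverse is a constant permutation matrix, which makes
`Dt` diagonal. -/
theorem exists_feasible (M : LatentModel n) (I : Equiv.Perm (Fin n))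
    (hq : ∀ i, IsMechanism (q i)) (hqt : ∀ i, IsMechanism (qt i))
    (hdisc : ∀ i, InterventionalDiscrepancy (q i) (qt i)) (hg : IsDiffeoOntoImage g Set.univ)
    (hge : MeasurableEmbedding g) :
    ∃ h, IsDiffeoOntoImage h (Set.range g) ∧ (Dt (generatedData M q qt I I g) h).IsDiag := by
  obtain ⟨h, hh, hhg⟩ := exists_isDiffeoPair_perm hg I
  have H : IsDiffeoPair (h ∘ g) (fun w j => w (I.symm j)) := by
    rw [show h ∘ g = fun z m => z (I m) from funext hhg]
    exact isDiffeoPair_perm I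
  refine ⟨h, hh, fun i m him => ?_⟩
  refine (Dt_eq_zero_iff hq hqt hdisc hge hh.1.continuousOn H i m).2 fun z => ?_
  rw [fderiv_perm]
  simp [him.symm]

/-- The graph read off from a feasible encoder is the latent graph, relabelled. -/
theorem recoveredGraph_adj_iff (hq : ∀ i, IsMechanism (q i))
    (hg : MeasurableEmbedding g) (hh : ContinuousOn h (Set.range g))
    (H : IsDiffeoPair (h ∘ g) ψ)
    (hz : ∀ z i m, i ≠ m → fderiv ℝ ψ ((h ∘ g) z) (Pi.single i 1) (I m) = 0) (j m : Fin n) :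
    (recoveredGraph (generatedData M q qt I I g) h).Adj j m ↔ M.G.Adj (I j) (I m) := by
  change j ≠ m ∧ _ ≠ _ ↔ _
  by_cases hjm : j = m
  · subst hjm
    simp [M.not_adj_self]
  have hI : I j ≠ I m := I.injective.ne hjm
  rw [and_iff_right hjm, ← not_iff_not, ← M.fderiv_cond_eq_zero_iff hI, not_not,
    Dobs_eq_zero_iff hq hg hh H]
  refine forall_congr' fun z => ?_
  have hc : HasFDerivAt (M.cond (I m)) (fderiv ℝ (M.cond (I m)) z) z :=
    ((M.contDiff_cond (I m)).differentiable one_ne_zero z).hasFDerivAt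
  have hl := ((((hq (I m)).2.1.differentiable one_ne_zero (z (I m))).log
    ((hq (I m)).2.2 _)).hasDerivAt.comp_hasFDerivAt z (hasFDerivAt_apply (𝕜 := ℝ) (I m) z))
  have hsub : HasFDerivAt
      (fun z => Real.log (M.cond (I m) z) - Real.log (q (I m) (z (I m)))) _ z :=
    (hc.log (M.cond_pos _ z).ne').sub hl
  -- The direction is a nonzero multiple of the basis vector at `I j ≠ I m`, along which the `q`
  -- term is constant. What remains is the partial derivative of the conditional times nonzero
  -- factors.
  rw [hsub.fderiv, ← Function.comp_apply (f := h) (g := g),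
    IsDiffeoPair.fderiv_inv_single hz, map_smul]
  simp [H.fderiv_inv_single_ne_zero hz z j, hI.symm, (M.cond_pos (I m) z).ne',
    -Function.comp_apply]

end Recovery

end CRL

theorem theorem2 (n d : ℕ) (hnd : n ≤ d)
    (M : CRL.LatentModel n) (q qt : Fin n → ℝ → ℝ)
    (hq : ∀ i, CRL.IsMechanism (q i)) (hqt : ∀ i, CRL.IsMechanism (qt i))
    (hdisc : ∀ i, CRL.InterventionalDiscrepancy (q i) (qt i))
    (I It : Equiv.Perm (Fin n)) (hcoupled : I = It)
    (g : (Fin n → ℝ) → (Fin d → ℝ)) (hg : CRL.IsDiffeoOntoImage g Set.univ) :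
    (∃ h, CRL.IsSolution (CRL.generatedData M q qt I It g) h) ∧
    ∀ h, CRL.IsSolution (CRL.generatedData M q qt I It g) h →
      (∀ (z : Fin n → ℝ) (m j : Fin n),
        fderiv ℝ (h ∘ g) z (Pi.single j 1) m ≠ 0 ↔ j = I m) ∧
      CRL.PerfectLatentRecovery g h ∧
      CRL.PerfectDAGRecovery M.G
        (CRL.recoveredGraph (CRL.generatedData M q qt I It g) h) ∧
      ∀ m m' : Fin n,
        (CRL.recoveredGraph (CRL.generatedData M q qt I It g) h).Adj m m' ↔
          M.G.Adj (I m) (I m') := by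
  subst hcoupled
  obtain ⟨k, hk, -⟩ := hg.2
  have hge : MeasurableEmbedding g :=
    (contDiffOn_univ.1 hg.1).continuous.measurableEmbedding
      fun a b hab => by rw [← hk (Set.mem_univ a), ← hk (Set.mem_univ b), hab]
  have hval : ∀ {h}, CRL.IsValidEncoder (CRL.generatedData M q qt I I g) h →
      ContinuousOn h (Set.range g) ∧ ∃ ψ, CRL.IsDiffeoPair (h ∘ g) ψ := fun hh =>
    ⟨hh.1.continuousOn, (hg.comp_univ hh).exists_pair⟩
  have hl0 : ∀ {h}, CRL.IsValidEncoder (CRL.generatedData M q qt I I g) h →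
      (CRL.Dt (CRL.generatedData M q qt I I g) h).IsDiag →
      CRL.l0norm (CRL.Dt (CRL.generatedData M q qt I I g) h) = n := by
    intro h hh hD
    obtain ⟨hc, ψ, H⟩ := hval hh
    exact CRL.l0norm_Dt_eq hq hqt hdisc hge hc H hD
  refine ⟨?_, fun h hsol => ?_⟩
  · obtain ⟨h, hh, hD⟩ := CRL.exists_feasible M I hq hqt hdisc hg hge
    exact ⟨h, hh, hD, fun h' hh' hD' => (hl0 hh hD).trans_le (hl0 hh' hD').ge⟩
  · obtain ⟨hh, hD, -⟩ := hsol
    obtain ⟨hc, ψ, H⟩ := hval hh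
    have hz := CRL.fderiv_inv_eq_zero_of_isDiag hq hqt hdisc hge hc H hD
    have hJ := H.fderiv_ne_zero_iff hz
    have hG := CRL.recoveredGraph_adj_iff (M := M) (qt := qt) hq hge hc H hz
    obtain ⟨f, hf, hsurj, hφ⟩ := H.exists_coordinatewise hJ
    exact ⟨hJ, ⟨I, f, hf, hsurj, hφ⟩, ⟨⟨I, fun {a b} => (hG a b).symm⟩⟩, hG⟩
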